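/- Let $n\ge 0$ and $k\ge 1$ be integers, put $s_i=(2^k+1)2^{n+i}-(2^k-1)$ for $i\ge 0$, and let $GT(n,k)=\langle s_i : i\ge 0\rangle$ be the submonoid of $(\mathbb N,+)$ generated by all the $s_i$. For a submonoid $S\subseteq\mathbb N$ and $x\in S\setminus\{0\}$ let $\mathrm{Ap}(S,x)=\{w\in S : w-x\notin S\}$ (subtraction in $\mathbb Z$). Put $\delta=1$ if $n=0$, $\delta=k$ if $n\ne0$ and $k\le n$, and $\delta=k-1$ if $n\neq 0$ and $k>n$. For a sequence $t_1,t_2,\dots$ put $P_i=\sum_{j=1}^{i}(2^j-1)t_j$ and $Q_i=\sum_{j=1}^{i}t_js_j$. For $d\ge 1$ let $A(n,d)$ be the set of all $(t_1,\dots,t_{n+d})\in\{0,1,2\}^{n+d}$ such that $t_{n+d}\in\{0,1\}$ and, whenever $t_j=2$, $t_i=0$ for all $i<j$. Define the following sets of sequences. * $R(n)$ (for $n\ge1$) is the set of all $(t_1,\dots,t_{n+1})\in A(n,1)$ such that: $t_{n+1}\in\{0,1\}$; if $t_n=2$ then $t_{n+1}=0$; if $t_n=t_{n+1}=1$ then $t_i=0$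 for all $1\le i<n$. * $R_1(n,\delta)$ (for $2\le k<n$) is the set of all $(t_1,\dots,t_{n+\delta})\in A(n,\delta)$ such that, if $t_{n+\delta}=1$, then: $t_n=\dots=t_{n+\delta-1}=0$; $t_{n-1}\in\{0,1\}$; and if $t_{n-1}=1$ then $P_{n-2}\le 2^{n-1}-2^k+2$. * $R_2(n,\delta)$ (for $n=k\ge1$, so that $n+\delta=2n$) is the set of all $(t_1,\dots,t_{2n})\in A(n,\delta)$ such that, if $t_{2n}=1$, then $t_1\in\{0,1\}$ and $t_2=\dots=t_{2n-1}=0$. * $R_3(n,\delta)$ (for $n\ge1$, $k>n$, $k\ne2$) is the set of all $(t_1,\dots,t_{n+\delta})\in A(n,\delta)$ such that: if $t_{\delta+1}=\dots=t_{n+\delta}=1$ then $P_\delta\le 2^n+n$; and there is no $j$ with $\delta+1\le j\le n+\delta-1$, $t_j=2$ and $t_{j+1}=\dots=t_{n+\delta}=1$. Then $$\mathrm{Ap}(GT(n,k),s_0)=\begin{cases} \{0,s_1\} & \text{if } n=0,\\ \{Q_{n+1} : (t_1,\dots,t_{n+1})\in R(n)\} & \text{if } n\ne0,\ k=1,\\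 \{Q_{n+\delta} : (t_1,\dots,t_{n+\delta})\in R_1(n,\delta)\} & \text{if } 2\le k<n,\\ \{Q_{n+\delta} : (t_1,\dots,t_{n+\delta})\in R_2(n,\delta)\} & \text{if } n=k\ge1,\\ \{Q_{n+\delta} : (t_1,\dots,t_{n+\delta})\in R_3(n,\delta)\} & \text{if } n\ne0,\ k>n,\ k\ne2,\\ \{0,17,34,37,54,71,74\} & \text{if } n=1,\ k=2. \end{cases}$$ Moreover $\mathrm{Ap}(GT(n,k),s_0)$ has exactly $s_0$ elements, $\mathbb N\setminus GT(n,k)$ is finite, and its cardinality $g(GT(n,k))$ is $$g(GT(n,k))=\frac1{s_0}\sum_{w\in \mathrm{Ap}(GT(n,k),s_0)}w-\frac{s_0-1}{2}.$$ -/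

import Mathlib

namespace GenThabit

/-- `s n k i = (2^k + 1) * 2^(n+i) - (2^k - 1)`; both subtractions are exact in `ℕ`. -/
def s (n k i : ℕ) : ℕ := (2 ^ k + 1) * 2 ^ (n + i) - (2 ^ k - 1)

/-- The generalized Thabit numerical semigroup, the submonoid of `(ℕ, +)` generated by all
`s n k i`, `i ∈ ℕ`. -/
def GT (n k : ℕ) : AddSubmonoid ℕ := AddSubmonoid.closure (Set.range (s n k))

/-- The Apéry set `{w ∈ S | w - x ∉ S}`. The subtraction is that of `ℤ`, so `w - x ∈ S` means
that `w = t + x` for some `t ∈ S`. -/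
def Apery (S : AddSubmonoid ℕ) (x : ℕ) : Set ℕ := {w | w ∈ S ∧ ¬ ∃ t ∈ S, w = t + x}

/-- The number of natural numbers outside `S`. -/
noncomputable def genus (S : AddSubmonoid ℕ) : ℕ := ((S : Set ℕ)ᶜ).ncard

def delta (n k : ℕ) : ℕ := if n = 0 then 1 else if k ≤ n then k else k - 1

/-- `P t i = t_1 + (2^2 - 1) t_2 + ⋯ + (2^i - 1) t_i`. -/
def P (t : ℕ → ℕ) (i : ℕ) : ℕ := ∑ j ∈ Finset.Icc 1 i, (2 ^ j - 1) * t j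

/-- `Q n k t i = t_1 s_1 + ⋯ + t_i s_i`. -/
def Q (n k : ℕ) (t : ℕ → ℕ) (i : ℕ) : ℕ := ∑ j ∈ Finset.Icc 1 i, t j * s n k j

/-- `A(n, δ)`. A sequence `(t_1, …, t_{n+δ})` is a function `t : ℕ → ℕ` that vanishes outside
the indices `1, …, n + δ`. -/
def A (n δ : ℕ) : Set (ℕ → ℕ) :=
  {t | (∀ i, i ∉ Finset.Icc 1 (n + δ) → t i = 0) ∧
    (∀ i ∈ Finset.Icc 1 (n + δ), t i ∈ ({0, 1, 2} : Set ℕ)) ∧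
    t (n + δ) ∈ ({0, 1} : Set ℕ) ∧
    ∀ j ∈ Finset.Icc 1 (n + δ), t j = 2 → ∀ i, 1 ≤ i → i < j → t i = 0}

/-- `R(n)`, used for `k = 1`, where `δ = 1`. -/
def R (n : ℕ) : Set (ℕ → ℕ) :=
  {t | t ∈ A n 1 ∧ t (n + 1) ∈ ({0, 1} : Set ℕ) ∧
    (t n = 2 → t (n + 1) = 0) ∧
    (t n = 1 → t (n + 1) = 1 → ∀ i, 1 ≤ i → i < n → t i = 0)}

/-- `R_1(n, δ)`, used for `2 ≤ k < n`; for such `n, k` the subtractions are exact. -/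
def R₁ (n k : ℕ) : Set (ℕ → ℕ) :=
  {t | t ∈ A n (delta n k) ∧ (t (n + delta n k) = 1 →
    (∀ i, n ≤ i → i ≤ n + delta n k - 1 → t i = 0) ∧
    t (n - 1) ∈ ({0, 1} : Set ℕ) ∧
    (t (n - 1) = 1 → P t (n - 2) ≤ 2 ^ (n - 1) - 2 ^ k + 2))}

/-- `R_2(n, δ)`, used for `n = k ≥ 1`, where `n + δ = 2n`. -/
def R₂ (n k : ℕ) : Set (ℕ → ℕ) :=
  {t | t ∈ A n (delta n k) ∧ (t (2 * n) = 1 →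
    t 1 ∈ ({0, 1} : Set ℕ) ∧ ∀ i, 2 ≤ i → i ≤ 2 * n - 1 → t i = 0)}

/-- `R_3(n, δ)`, used for `n ≥ 1`, `k > n`, `k ≠ 2`. -/
def R₃ (n k : ℕ) : Set (ℕ → ℕ) :=
  {t | t ∈ A n (delta n k) ∧
    ((∀ i, delta n k + 1 ≤ i → i ≤ n + delta n k → t i = 1) →
      P t (delta n k) ≤ 2 ^ n + n) ∧
    ¬ ∃ j, delta n k + 1 ≤ j ∧ j ≤ n + delta n k - 1 ∧ t j = 2 ∧
      ∀ i, j + 1 ≤ i → i ≤ n + delta n k → t i = 1}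

end GenThabit

/-!
Put `x = s n k 0` and `y = (2 ^ k + 1) * 2 ^ n`, so that `s n k i = x + y * (2 ^ i - 1)`. The
elements of `GT n k` are then the numbers `x * N + y * p` for which `p` is a sum of `N` numbers of
the form `2 ^ i - 1`, the summand `0` being allowed. Since `x` and `y` are coprime and `x ≤ y`, the
smallest element congruent to `y * p` modulo `x`, where `p < x`, is the one with the same `p` and
the least possible `N`.

A sum of `N` numbers `2 ^ i - 1` becomes a sum of `N` powers of `2` when `N` is added to it, so
`p + N` has at most `N` binary ones. The greedy representation of `p`, whose digits are `0` and `1`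
with a possible lowest nonzero digit `2`, has a digit sum `N` for which `p + N - 1` has at least
`N` binary ones, and therefore it is the shortest one. What remains is to read off from the digits
whether `p < x`, which is what the sets `R`, `R₁`, `R₂` and `R₃` encode.
-/

namespace GenThabit

/-! ### Apéry sets and Selmer's formula -/

section NumericalSemigroup

variable {S : AddSubmonoid ℕ} {x v w y : ℕ}

theorem mem_iff_of_modEq_of_mem_Apery (hx : x ∈ S) (hw : w ∈ Apery S x) (h : y ≡ w [MOD x]) :
    y ∈ S ↔ w ≤ y := by
  constructor
  · intro hy
    by_contra! hlt
    obtain ⟨c, hc⟩ := (Nat.modEq_iff_dvd' hlt.le).1 h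
    obtain ⟨c, rfl⟩ : ∃ b, c = b + 1 := Nat.exists_eq_succ_of_ne_zero (by rintro rfl; omega)
    refine hw.2 ⟨y + c • x, S.add_mem hy (S.nsmul_mem hx c), ?_⟩
    rw [smul_eq_mul]
    linarith [Nat.sub_add_cancel hlt.le]
  · intro hle
    obtain ⟨c, hc⟩ := (Nat.modEq_iff_dvd' hle).1 h.symm
    rw [← Nat.add_sub_cancel' hle, hc, mul_comm]
    exact S.add_mem hw.1 (S.nsmul_mem hx c)

theorem eq_of_modEq_of_mem_Apery (hx : x ∈ S) (hv : v ∈ Apery S x) (hw : w ∈ Apery S x)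
    (h : v ≡ w [MOD x]) : v = w :=
  le_antisymm ((mem_iff_of_modEq_of_mem_Apery hx hv h.symm).1 hw.1)
    ((mem_iff_of_modEq_of_mem_Apery hx hw h).1 hv.1)

theorem exists_mem_Apery_modEq_of_mem (hx0 : x ≠ 0) (hy : y ∈ S) :
    ∃ w ∈ Apery S x, w ≡ y [MOD x] := by
  induction y using Nat.strong_induction_on with
  | _ y ih =>
    by_cases h : ∃ t ∈ S, y = t + x
    · obtain ⟨t, ht, rfl⟩ := h
      obtain ⟨w, hw, hwt⟩ := ih t (by omega) ht
      exact ⟨w, hw, hwt.trans (Nat.add_modEq_right (n := x) (a := t)).symm⟩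
    · exact ⟨y, ⟨hy, h⟩, rfl⟩

theorem exists_mem_Apery_modEq (hS : (S : Set ℕ)ᶜ.Finite) (hx0 : x ≠ 0) (y : ℕ) :
    ∃ w ∈ Apery S x, w ≡ y [MOD x] := by
  obtain ⟨b, hb⟩ := hS.bddAbove
  have hmem : y + x * (b + 1) ∈ S := by
    by_contra h
    nlinarith [hb h, Nat.pos_of_ne_zero hx0]
  obtain ⟨w, hw, hwy⟩ := exists_mem_Apery_modEq_of_mem hx0 hmem
  exact ⟨w, hw, hwy.trans (by simp [Nat.ModEq])⟩

theorem mapsTo_mod_Apery (hx0 : x ≠ 0) : Set.MapsTo (· % x) (Apery S x) (Finset.range x) :=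
  fun w _ ↦ Finset.mem_coe.2 (Finset.mem_range.2 (Nat.mod_lt w (Nat.pos_of_ne_zero hx0)))

theorem injOn_mod_Apery (hx : x ∈ S) : Set.InjOn (· % x) (Apery S x) :=
  fun _ hv _ hw h ↦ eq_of_modEq_of_mem_Apery hx hv hw h

theorem surjOn_mod_Apery (hS : (S : Set ℕ)ᶜ.Finite) (hx0 : x ≠ 0) :
    Set.SurjOn (· % x) (Apery S x) (Finset.range x) := by
  intro r hr
  obtain ⟨w, hw, hwr⟩ := exists_mem_Apery_modEq hS hx0 r
  exact ⟨w, hw, Eq.trans hwr (Nat.mod_eq_of_lt (by simpa using hr))⟩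

theorem bijOn_mod_Apery (hS : (S : Set ℕ)ᶜ.Finite) (hx : x ∈ S) (hx0 : x ≠ 0) :
    Set.BijOn (· % x) (Apery S x) (Finset.range x) :=
  ⟨mapsTo_mod_Apery hx0, injOn_mod_Apery hx, surjOn_mod_Apery hS hx0⟩

theorem finite_Apery (hx : x ∈ S) (hx0 : x ≠ 0) : (Apery S x).Finite :=
  Set.Finite.of_injOn (mapsTo_mod_Apery hx0) (injOn_mod_Apery hx) (Finset.finite_toSet _)

theorem ncard_Apery (hS : (S : Set ℕ)ᶜ.Finite) (hx : x ∈ S) (hx0 : x ≠ 0) :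
    (Apery S x).ncard = x := by
  rw [(bijOn_mod_Apery hS hx hx0).ncard_eq, Set.ncard_coe_finset, Finset.card_range]

theorem Apery_eq_of_subset {B : Set ℕ} (hx : x ∈ S) (hB : B ⊆ Apery S x)
    (hres : ∀ w ∈ S, ∃ b ∈ B, b ≡ w [MOD x]) : Apery S x = B := by
  refine Set.Subset.antisymm (fun w hw ↦ ?_) hB
  obtain ⟨b, hb, hbw⟩ := hres w hw.1
  rwa [← eq_of_modEq_of_mem_Apery hx (hB hb) hw hbw]

theorem compl_eq_biUnion_Apery (hS : (S : Set ℕ)ᶜ.Finite) (hx : x ∈ S) (hx0 : x ≠ 0) :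
    (S : Set ℕ)ᶜ = ((finite_Apery hx hx0).toFinset.biUnion fun w ↦
      (Finset.range w).filter (· ≡ w [MOD x]) : Finset ℕ) := by
  ext y
  simp only [Set.mem_compl_iff, SetLike.mem_coe, Finset.mem_biUnion,
    Set.Finite.mem_toFinset, Finset.mem_filter, Finset.mem_range]
  constructor
  · intro hy
    obtain ⟨w, hw, hwy⟩ := exists_mem_Apery_modEq hS hx0 y
    exact ⟨w, hw, not_le.1 (mt (mem_iff_of_modEq_of_mem_Apery hx hw hwy.symm).2 hy), hwy.symm⟩
  · rintro ⟨w, hw, hlt, hyw⟩ hy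
    exact hlt.not_ge ((mem_iff_of_modEq_of_mem_Apery hx hw hyw).1 hy)

theorem genus_eq_sum_div (hS : (S : Set ℕ)ᶜ.Finite) (hx : x ∈ S) (hx0 : x ≠ 0) :
    genus S = ∑ w ∈ (finite_Apery hx hx0).toFinset, w / x := by
  rw [genus, compl_eq_biUnion_Apery hS hx hx0, Set.ncard_coe_finset, Finset.card_biUnion]
  · refine Finset.sum_congr rfl fun w _ ↦ ?_
    rw [← Nat.count_eq_card_filter_range, Nat.count_modEq_card w (Nat.pos_of_ne_zero hx0),
      if_neg (lt_irrefl _), add_zero]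
  · intro v hv w hw hvw
    refine Finset.disjoint_left.2 fun y hyv hyw ↦ ?_
    refine hvw (eq_of_modEq_of_mem_Apery hx (by simpa using hv) (by simpa using hw) ?_)
    exact (Finset.mem_filter.1 hyv).2.symm.trans (Finset.mem_filter.1 hyw).2

theorem sum_Apery_eq (hS : (S : Set ℕ)ᶜ.Finite) (hx : x ∈ S) (hx0 : x ≠ 0) :
    ∑ w ∈ (finite_Apery hx hx0).toFinset, w = ∑ r ∈ Finset.range x, r + x * genus S := by
  have hmod : ∑ w ∈ (finite_Apery hx hx0).toFinset, w % x = ∑ r ∈ Finset.range x, r := by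
    have hbij := bijOn_mod_Apery hS hx hx0
    rw [← (finite_Apery hx hx0).coe_toFinset] at hbij
    exact Finset.sum_nbij (· % x) hbij.mapsTo hbij.injOn hbij.surjOn fun _ _ ↦ rfl
  rw [genus_eq_sum_div hS hx hx0, ← hmod, Finset.mul_sum, ← Finset.sum_add_distrib]
  exact Finset.sum_congr rfl fun w _ ↦ (Nat.mod_add_div w x).symm

theorem genus_eq (hS : (S : Set ℕ)ᶜ.Finite) (hx : x ∈ S) (hx0 : x ≠ 0) :
    (genus S : ℚ) = 1 / (x : ℚ) * (∑ᶠ w ∈ Apery S x, (w : ℚ)) - ((x : ℚ) - 1) / 2 := by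
  have hrange : ((∑ r ∈ Finset.range x, r : ℕ) : ℚ) * 2 = x * (x - 1) := by
    rw [← Nat.cast_two, ← Nat.cast_mul, Finset.sum_range_id_mul_two, Nat.cast_mul,
      Nat.cast_pred (Nat.pos_of_ne_zero hx0)]
  have hsum : ∑ᶠ w ∈ Apery S x, (w : ℚ) = (∑ r ∈ Finset.range x, r : ℕ) + x * genus S := by
    rw [finsum_mem_eq_finite_toFinset_sum _ (finite_Apery hx hx0), ← Nat.cast_sum,
      sum_Apery_eq hS hx hx0, Nat.cast_add, Nat.cast_mul]
  have hx0' : (x : ℚ) ≠ 0 := Nat.cast_ne_zero.2 hx0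
  rw [hsum]
  field_simp
  linarith

theorem finite_compl_of_coprime (hx : x ∈ S) (hy : y ∈ S) (hxy : x.Coprime y) :
    (S : Set ℕ)ᶜ.Finite := by
  obtain ⟨b, hb⟩ := Nat.exists_mem_closure_of_ge {x, y}
  have hgcd : Nat.setGcd {x, y} ∣ 1 := hxy ▸
    Nat.dvd_gcd (Nat.setGcd_dvd_of_mem (by simp)) (Nat.setGcd_dvd_of_mem (by simp))
  have hle : AddSubmonoid.closure {x, y} ≤ S :=
    AddSubmonoid.closure_le.2 (Set.pair_subset hx hy)
  refine (Set.finite_lt_nat b).subset fun w hw ↦ ?_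
  by_contra! h
  exact hw (hle (hb w (not_lt.1 h) (hgcd.trans (one_dvd w))))

end NumericalSemigroup

/-! ### Sums of numbers of the form `2 ^ i - 1` -/

/-- The number of ones in the binary expansion. It is subadditive, which bounds from below the
number of summands `2 ^ i - 1` needed to represent a given number. -/
def bitCount (a : ℕ) : ℕ := (Nat.digits 2 a).sum

theorem bitCount_zero : bitCount 0 = 0 := by simp [bitCount]

theorem bitCount_add_two_mul {b : ℕ} (hb : b < 2) (a : ℕ) :
    bitCount (b + 2 * a) = b + bitCount a := by
  by_cases h : b = 0 ∧ a = 0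
  · rw [h.1, h.2, mul_zero, zero_add, bitCount_zero]
  · rw [bitCount, Nat.digits_add 2 one_lt_two b a hb (by omega), List.sum_cons, bitCount]

theorem bitCount_add_two_pow {a L : ℕ} (h : a < 2 ^ L) : bitCount (a + 2 ^ L) = bitCount a + 1 := by
  induction L generalizing a with
  | zero =>
    obtain rfl : a = 0 := by simpa using h
    simp [bitCount]
  | succ L ih =>
    have hmod : a % 2 < 2 := Nat.mod_lt a two_pos
    calc bitCount (a + 2 ^ (L + 1)) = bitCount (a % 2 + 2 * (a / 2 + 2 ^ L)) := by congr 1; omega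
      _ = a % 2 + bitCount (a / 2) + 1 := by
        rw [bitCount_add_two_mul hmod, ih (by omega), add_assoc]
      _ = bitCount a + 1 := by rw [← bitCount_add_two_mul hmod, Nat.mod_add_div]

theorem bitCount_two_pow (L : ℕ) : bitCount (2 ^ L) = 1 := by
  simpa [bitCount_zero] using bitCount_add_two_pow (Nat.two_pow_pos L)

theorem bitCount_two_pow_sub_one (L : ℕ) : bitCount (2 ^ L - 1) = L := by
  induction L with
  | zero => exact bitCount_zero
  | succ L ih =>
    have hpos := Nat.two_pow_pos L
    rw [show 2 ^ (L + 1) - 1 = 2 ^ L - 1 + 2 ^ L by omega, bitCount_add_two_pow (by omega), ih]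

theorem padicValNat_two_factorial_add_bitCount (a : ℕ) :
    padicValNat 2 a.factorial + bitCount a = a := by
  have legendre : (2 - 1) * padicValNat 2 a.factorial = a - bitCount a :=
    sub_one_mul_padicValNat_factorial a
  have := Nat.digit_sum_le 2 a
  rw [bitCount] at legendre ⊢
  omega

/-- By Legendre's formula this says that `a! * b!` divides `(a + b)!`, up to odd factors. -/
theorem bitCount_add_le (a b : ℕ) : bitCount (a + b) ≤ bitCount a + bitCount b := by
  have hval : padicValNat 2 a.factorial + padicValNat 2 b.factorial ≤
      padicValNat 2 (a + b).factorial := by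
    rw [← padicValNat.mul a.factorial_ne_zero b.factorial_ne_zero]
    exact (padicValNat_dvd_iff_le (a + b).factorial_ne_zero).1
      (pow_padicValNat_dvd.trans (Nat.factorial_mul_factorial_dvd_factorial_add a b))
  have ha := padicValNat_two_factorial_add_bitCount a
  have hb := padicValNat_two_factorial_add_bitCount b
  have hab := padicValNat_two_factorial_add_bitCount (a + b)
  omega

/-- The pairs `(N, p)` such that `p` is a sum of `N` numbers of the form `2 ^ i - 1`. The summand
`2 ^ 0 - 1 = 0` is allowed, so `N` may be enlarged at will. -/
def mersenneSums : AddSubmonoid (ℕ × ℕ) :=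
  AddSubmonoid.closure (Set.range fun i : ℕ ↦ (1, 2 ^ i - 1))

theorem one_mem_mersenneSums (i : ℕ) : (1, 2 ^ i - 1) ∈ mersenneSums :=
  AddSubmonoid.subset_closure ⟨i, rfl⟩

theorem mersenneSums_mono {M N p : ℕ} (hMN : M ≤ N) (h : (M, p) ∈ mersenneSums) :
    (N, p) ∈ mersenneSums := by
  have := mersenneSums.add_mem h (mersenneSums.nsmul_mem (one_mem_mersenneSums 0) (N - M))
  simpa [Nat.add_sub_cancel' hMN] using this

theorem self_mem_mersenneSums (p : ℕ) : (p, p) ∈ mersenneSums := by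
  simpa using mersenneSums.nsmul_mem (one_mem_mersenneSums 1) p

theorem bitCount_add_le_of_mem_mersenneSums {N p : ℕ} (h : (N, p) ∈ mersenneSums) :
    bitCount (p + N) ≤ N := by
  suffices ∀ a ∈ mersenneSums, bitCount (a.2 + a.1) ≤ a.1 from this _ h
  intro a ha
  induction ha using AddSubmonoid.closure_induction with
  | mem a ha =>
    obtain ⟨i, rfl⟩ := ha
    rw [Nat.sub_add_cancel Nat.one_le_two_pow, bitCount_two_pow]
  | zero => exact bitCount_zero.le
  | add a b _ _ ha hb =>
    calc bitCount ((a + b).2 + (a + b).1)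
        = bitCount (a.2 + a.1 + (b.2 + b.1)) := by
          rw [Prod.fst_add, Prod.snd_add, add_add_add_comm]
      _ ≤ a.1 + b.1 := (bitCount_add_le _ _).trans (add_le_add ha hb)

/-- The least number of summands of the form `2 ^ i - 1` that add up to `p`. -/
noncomputable def mersenneLength (p : ℕ) : ℕ := sInf {N | (N, p) ∈ mersenneSums}

theorem mersenneLength_le {N p : ℕ} (h : (N, p) ∈ mersenneSums) : mersenneLength p ≤ N :=
  Nat.sInf_le (s := {N | (N, p) ∈ mersenneSums}) h

theorem mersenneLength_le_self (p : ℕ) : mersenneLength p ≤ p :=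
  mersenneLength_le (self_mem_mersenneSums p)

theorem mersenneLength_mem_mersenneSums (p : ℕ) : (mersenneLength p, p) ∈ mersenneSums :=
  Nat.sInf_mem (s := {N | (N, p) ∈ mersenneSums}) ⟨p, self_mem_mersenneSums p⟩

theorem mersenneLength_eq {N p : ℕ} (h : (N, p) ∈ mersenneSums)
    (hN : N ≤ bitCount (p + N - 1)) : mersenneLength p = N := by
  refine (mersenneLength_le h).antisymm (not_lt.1 fun hlt ↦ ?_)
  have hpred : (N - 1, p) ∈ mersenneSums :=
    mersenneSums_mono (Nat.le_sub_one_of_lt hlt) (mersenneLength_mem_mersenneSums p)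
  have := bitCount_add_le_of_mem_mersenneSums hpred
  rw [← Nat.add_sub_assoc (by omega)] at this
  omega

/-- The submonoid of `(ℕ, +)` generated by the numbers `x + y * (2 ^ i - 1)`. It is `GT n k` for
`x = s n k 0` and `y = (2 ^ k + 1) * 2 ^ n`. -/
def mersenneMonoid (x y : ℕ) : AddSubmonoid ℕ :=
  AddSubmonoid.closure (Set.range fun i ↦ x + y * (2 ^ i - 1))

theorem add_mul_mem_mersenneMonoid (x y i : ℕ) : x + y * (2 ^ i - 1) ∈ mersenneMonoid x y :=
  AddSubmonoid.subset_closure ⟨i, rfl⟩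

theorem mem_mersenneMonoid_iff {x y w : ℕ} :
    w ∈ mersenneMonoid x y ↔ ∃ N p, (N, p) ∈ mersenneSums ∧ x * N + y * p = w := by
  let f : ℕ × ℕ →+ ℕ := (AddMonoidHom.mulLeft x).coprod (AddMonoidHom.mulLeft y)
  have hmap : mersenneMonoid x y = mersenneSums.map f := by
    rw [mersenneSums, AddMonoidHom.map_mclosure, ← Set.range_comp, mersenneMonoid]
    congr 2
    funext i
    simp [f]
  simp [hmap, f]

theorem finite_compl_mersenneMonoid {x y : ℕ} (hxy : x.Coprime y) :
    (mersenneMonoid x y : Set ℕ)ᶜ.Finite := by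
  refine finite_compl_of_coprime (add_mul_mem_mersenneMonoid x y 0)
    (add_mul_mem_mersenneMonoid x y 1) ?_
  simpa using hxy

theorem mul_mersenneLength_add_mul_mem_Apery {x y p : ℕ} (hxy : x.Coprime y) (hle : x ≤ y)
    (hp : p < x) : x * mersenneLength p + y * p ∈ Apery (mersenneMonoid x y) x := by
  refine ⟨mem_mersenneMonoid_iff.2 ⟨_, p, mersenneLength_mem_mersenneSums p, rfl⟩, ?_⟩
  rintro ⟨_, ht, heq⟩
  obtain ⟨N, q, hNq, rfl⟩ := mem_mersenneMonoid_iff.1 ht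
  have hmod : p ≡ q [MOD x] := Nat.ModEq.cancel_left_of_coprime hxy <| by
    simpa [Nat.ModEq, Nat.mul_add_mod] using congrArg (· % x) heq
  obtain ⟨c, rfl⟩ : ∃ c, q = p + x * c :=
    ⟨q / x, by rw [← Nat.mod_eq_of_lt hp, hmod, Nat.mod_add_div]⟩
  have hlen : mersenneLength p = N + 1 + y * c :=
    Nat.eq_of_mul_eq_mul_left (Nat.zero_lt_of_lt hp) (by linarith)
  have hlep := mersenneLength_le_self p
  obtain rfl | hc := Nat.eq_zero_or_pos c
  · have := mersenneLength_le hNq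
    rw [mul_zero, add_zero] at hlen this
    omega
  · have := Nat.le_mul_of_pos_right y hc
    omega

theorem Apery_mersenneMonoid {x y : ℕ} (hx0 : x ≠ 0) (hxy : x.Coprime y) (hle : x ≤ y) :
    Apery (mersenneMonoid x y) x =
      ((Finset.range x).image fun p ↦ x * mersenneLength p + y * p : Finset ℕ) := by
  refine Apery_eq_of_subset (by simpa using add_mul_mem_mersenneMonoid x y 0) ?_ ?_
  · simp only [Finset.coe_image, Finset.coe_range, Set.image_subset_iff]
    exact fun p hp ↦ mul_mersenneLength_add_mul_mem_Apery hxy hle hp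
  · intro w hw
    obtain ⟨N, p, -, rfl⟩ := mem_mersenneMonoid_iff.1 hw
    refine ⟨_, Finset.mem_coe.2 (Finset.mem_image_of_mem _ (Finset.mem_range.2
      (Nat.mod_lt p (Nat.pos_of_ne_zero hx0)))), ?_⟩
    simp [Nat.ModEq, Nat.mul_mod]

/-! ### Greedy digits -/

/-- The condition on the digits in the definition of `A n δ`: they are at most `2`, and a digit `2`
is preceded by zeros only. -/
def IsGreedy (t : ℕ → ℕ) : Prop :=
  ∀ j, t j ≤ 2 ∧ (t j = 2 → ∀ i, 1 ≤ i → i < j → t i = 0)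

/-- The digit sum `t_1 + ⋯ + t_L`. -/
def digitSum (t : ℕ → ℕ) (L : ℕ) : ℕ := ∑ j ∈ Finset.Icc 1 L, t j

section Digits

variable {t : ℕ → ℕ} {i j L : ℕ}

theorem P_zero (t : ℕ → ℕ) : P t 0 = 0 := by simp [P]

theorem P_succ (t : ℕ → ℕ) (L : ℕ) : P t (L + 1) = P t L + (2 ^ (L + 1) - 1) * t (L + 1) :=
  Finset.sum_Icc_succ_top (by omega) _

theorem P_one (t : ℕ → ℕ) : P t 1 = t 1 := by simp [P]

theorem digitSum_succ (t : ℕ → ℕ) (L : ℕ) : digitSum t (L + 1) = digitSum t L + t (L + 1) :=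
  Finset.sum_Icc_succ_top (by omega) _

theorem P_congr {u : ℕ → ℕ} (h : ∀ i, 1 ≤ i → i ≤ L → t i = u i) : P t L = P u L :=
  Finset.sum_congr rfl fun j hj ↦ by rw [h j (Finset.mem_Icc.1 hj).1 (Finset.mem_Icc.1 hj).2]

theorem mul_le_P (hi : 1 ≤ i) (hiL : i ≤ L) : (2 ^ i - 1) * t i ≤ P t L :=
  Finset.single_le_sum (f := fun j ↦ (2 ^ j - 1) * t j) (fun _ _ ↦ Nat.zero_le _)
    (Finset.mem_Icc.2 ⟨hi, hiL⟩)

theorem P_eq_of_eq_zero (hij : i ≤ j) (h : ∀ l, i + 1 ≤ l → l ≤ j → t l = 0) :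
    P t j = P t i := by
  induction j, hij using Nat.le_induction with
  | base => rfl
  | succ j hj ih =>
    rw [P_succ, h (j + 1) (by omega) le_rfl, mul_zero, add_zero]
    exact ih fun l h1 h2 ↦ h l h1 (by omega)

theorem P_add_of_eq_one (hij : i ≤ j) (h : ∀ l, i + 1 ≤ l → l ≤ j → t l = 1) :
    P t j + 2 ^ (i + 1) + (j - i) = P t i + 2 ^ (j + 1) := by
  induction j, hij using Nat.le_induction with
  | base => omega
  | succ j hj ih =>
    have := ih fun l h1 h2 ↦ h l h1 (by omega)
    have hpos := Nat.two_pow_pos (j + 1)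
    rw [P_succ, h (j + 1) (by omega) le_rfl, mul_one, pow_succ 2 (j + 1)]
    omega

theorem P_le_iff {c : ℕ} (hij : i ≤ j) (hc : c + 1 < 2 ^ (i + 1)) :
    P t j ≤ c ↔ (∀ l, i + 1 ≤ l → l ≤ j → t l = 0) ∧ P t i ≤ c := by
  constructor
  · intro hP
    have hzero : ∀ l, i + 1 ≤ l → l ≤ j → t l = 0 := by
      intro l hl hlj
      by_contra hne
      have hle := (Nat.le_mul_of_pos_right (2 ^ l - 1) (Nat.pos_of_ne_zero hne)).trans
        (mul_le_P (by omega) hlj)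
      have hpow := Nat.pow_le_pow_right two_pos hl
      omega
    exact ⟨hzero, P_eq_of_eq_zero hij hzero ▸ hP⟩
  · rintro ⟨hzero, hP⟩
    rwa [P_eq_of_eq_zero hij hzero]

theorem P_eq_zero_iff : P t L = 0 ↔ ∀ i, 1 ≤ i → i ≤ L → t i = 0 := by
  simpa [P_zero] using P_le_iff (t := t) (c := 0) (Nat.zero_le L) (by norm_num)

theorem digitSum_eq_zero_iff : digitSum t L = 0 ↔ P t L = 0 := by
  simp [P_eq_zero_iff, digitSum]

theorem digitSum_mem_mersenneSums (t : ℕ → ℕ) (L : ℕ) :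
    (digitSum t L, P t L) ∈ mersenneSums := by
  induction L with
  | zero => exact mersenneSums.zero_mem
  | succ L ih =>
    rw [digitSum_succ, P_succ]
    simpa [mul_comm] using
      mersenneSums.add_mem ih (mersenneSums.nsmul_mem (one_mem_mersenneSums (L + 1)) (t (L + 1)))

namespace IsGreedy

theorem P_eq_zero_of_eq_two (ht : IsGreedy t) (h : t (L + 1) = 2) : P t L = 0 :=
  P_eq_zero_iff.2 fun i hi hiL ↦ (ht (L + 1)).2 h i hi (Nat.lt_succ_of_le hiL)

theorem P_add_two_le (ht : IsGreedy t) (L : ℕ) : P t L + 2 ≤ 2 ^ (L + 1) := by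
  induction L with
  | zero => simp [P_zero]
  | succ L ih =>
    have hle := (ht (L + 1)).1
    have htwo := ht.P_eq_zero_of_eq_two (L := L)
    rw [P_succ, pow_succ 2 (L + 1)]
    interval_cases t (L + 1) <;> omega

theorem P_add_digitSum_le (ht : IsGreedy t) (L : ℕ) : P t L + digitSum t L ≤ 2 ^ (L + 1) := by
  induction L with
  | zero => simp [P_zero, digitSum]
  | succ L ih =>
    have hle := (ht (L + 1)).1
    have htwo := ht.P_eq_zero_of_eq_two (L := L)
    have hsum := digitSum_eq_zero_iff (t := t) (L := L)
    have hpos := Nat.two_pow_pos (L + 1)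
    rw [P_succ, digitSum_succ, pow_succ 2 (L + 1)]
    interval_cases t (L + 1) <;> omega

/-- Here `P t L + digitSum t L` is the sum of the `t_j * 2 ^ j`. If `j` is the lowest index of a
nonzero digit, then subtracting `1` turns the term `t_j * 2 ^ j` into a block of `j` ones if
`t_j = 1`, of `j + 1` ones if `t_j = 2`, and leaves the higher ones in place. -/
theorem digitSum_le_bitCount (ht : IsGreedy t) (L : ℕ) :
    digitSum t L ≤ bitCount (P t L + digitSum t L - 1) := by
  induction L with
  | zero => simp [digitSum]
  | succ L ih =>
    have hpos := Nat.two_pow_pos (L + 1)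
    rw [P_succ, digitSum_succ]
    obtain h0 | h0 := Nat.eq_zero_or_pos (digitSum t L)
    · rw [digitSum_eq_zero_iff.1 h0, h0, zero_add, zero_add]
      have hle := (ht (L + 1)).1
      interval_cases t (L + 1)
      · exact Nat.zero_le _
      · rw [mul_one, Nat.sub_add_cancel hpos, bitCount_two_pow_sub_one]
        omega
      · rw [show (2 ^ (L + 1) - 1) * 2 + 2 - 1 = 2 ^ (L + 2) - 1 by
          rw [pow_succ 2 (L + 1)]; omega,
          bitCount_two_pow_sub_one]
        omega
    · have hlt : P t L + digitSum t L - 1 < 2 ^ (L + 1) := by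
        have := ht.P_add_digitSum_le L
        omega
      have hle : t (L + 1) ≤ 1 := by
        have htwo : t (L + 1) ≠ 2 := fun h ↦
          h0.ne' (digitSum_eq_zero_iff.2 (ht.P_eq_zero_of_eq_two h))
        have := (ht (L + 1)).1
        omega
      interval_cases t (L + 1)
      · exact ih
      · rw [show P t L + (2 ^ (L + 1) - 1) * 1 + (digitSum t L + 1) - 1 =
          P t L + digitSum t L - 1 + 2 ^ (L + 1) by omega, bitCount_add_two_pow hlt]
        exact Nat.succ_le_succ ih

theorem mersenneLength_P (ht : IsGreedy t) (L : ℕ) : mersenneLength (P t L) = digitSum t L :=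
  mersenneLength_eq (digitSum_mem_mersenneSums t L) (ht.digitSum_le_bitCount L)

theorem update {c : ℕ} (ht : IsGreedy t) (hsupp : ∀ i, i ∉ Finset.Icc 1 L → t i = 0) (hc : c ≤ 2)
    (hc2 : c = 2 → t = 0) : IsGreedy (Function.update t (L + 1) c) := by
  intro j
  obtain rfl | hj := eq_or_ne j (L + 1)
  · rw [Function.update_self]
    refine ⟨hc, fun h i _ hi ↦ ?_⟩
    rw [Function.update_of_ne hi.ne, hc2 h, Pi.zero_apply]
  · rw [Function.update_of_ne hj]
    refine ⟨(ht j).1, fun h i hi hij ↦ ?_⟩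
    have hjL : j ∈ Finset.Icc 1 L := by
      by_contra hmem
      rw [hsupp j hmem] at h
      omega
    rw [Function.update_of_ne (by have := (Finset.mem_Icc.1 hjL).2; omega)]
    exact (ht j).2 h i hi hij

theorem exists_P_eq {p : ℕ} (hp : p + 2 ≤ 2 ^ (L + 1)) :
    ∃ t, IsGreedy t ∧ (∀ i, i ∉ Finset.Icc 1 L → t i = 0) ∧ P t L = p := by
  induction L generalizing p with
  | zero => exact ⟨0, fun j ↦ by simp, fun _ _ ↦ rfl, by rw [P_zero]; omega⟩
  | succ L ih =>
    have append_digit : ∀ c, c ≤ 2 → ∀ u, IsGreedy u → (∀ i, i ∉ Finset.Icc 1 L → u i = 0) →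
        (c = 2 → u = 0) → P u L + (2 ^ (L + 1) - 1) * c = p →
        ∃ t, IsGreedy t ∧ (∀ i, i ∉ Finset.Icc 1 (L + 1) → t i = 0) ∧ P t (L + 1) = p := by
      intro c hc u hu hsupp hc2 hPu
      refine ⟨Function.update u (L + 1) c, hu.update hsupp hc hc2, fun i hi ↦ ?_, ?_⟩
      · rw [Finset.mem_Icc] at hi
        rw [Function.update_of_ne (by rintro rfl; omega)]
        exact hsupp i (by rw [Finset.mem_Icc]; omega)
      · rw [P_succ, Function.update_self, ← hPu,
          P_congr fun i _ hi ↦ Function.update_of_ne (by omega) c u]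
    by_cases hzero : p + 2 ≤ 2 ^ (L + 1)
    · obtain ⟨u, hu, hsupp, hPu⟩ := ih hzero
      exact append_digit 0 (by omega) u hu hsupp (by omega) (by omega)
    by_cases hone : p + 3 ≤ 2 * 2 ^ (L + 1)
    · obtain ⟨u, hu, hsupp, hPu⟩ := ih (p := p - (2 ^ (L + 1) - 1)) (by omega)
      exact append_digit 1 (by omega) u hu hsupp (by omega) (by omega)
    · refine append_digit 2 le_rfl 0 (fun j ↦ by simp) (fun _ _ ↦ rfl) (fun _ ↦ rfl) ?_
      rw [(P_eq_zero_iff (t := 0)).2 fun _ _ _ ↦ rfl]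
      omega

theorem P_lt_two_pow_iff (ht : IsGreedy t) :
    P t (L + 1) < 2 ^ (L + 1) ↔ t (L + 1) ≠ 2 ∧ (t (L + 1) = 1 → P t L = 0) := by
  have hle := (ht (L + 1)).1
  have hP := ht.P_add_two_le L
  rw [P_succ]
  interval_cases t (L + 1) <;> omega

theorem P_add_of_eq_two (ht : IsGreedy t) (hj : 1 ≤ j) (hjL : j ≤ L) (htj : t j = 2)
    (hones : ∀ l, j + 1 ≤ l → l ≤ L → t l = 1) : P t L + 2 + (L - j) = 2 ^ (L + 1) := by
  obtain ⟨j, rfl⟩ := Nat.exists_eq_add_of_le' hj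
  have hP := P_add_of_eq_one hjL hones
  have hpos := Nat.two_pow_pos (j + 1)
  rw [P_succ, ht.P_eq_zero_of_eq_two htj, htj, pow_succ 2 (j + 1)] at hP
  omega

theorem P_add_le_of_eq_zero (ht : IsGreedy t) (hj : 1 ≤ j) (hjL : j ≤ L) (htj : t j = 0)
    (hones : ∀ l, j + 1 ≤ l → l ≤ L → t l = 1) : P t L + 2 ^ j ≤ 2 ^ (L + 1) := by
  obtain ⟨j, rfl⟩ := Nat.exists_eq_add_of_le' hj
  have hP := P_add_of_eq_one hjL hones
  rw [P_succ, htj] at hP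
  have := ht.P_add_two_le j
  omega

end IsGreedy

theorem exists_last_ne_one (hij : i ≤ L) (hi : t i ≠ 1) :
    ∃ j, i ≤ j ∧ j ≤ L ∧ t j ≠ 1 ∧ ∀ l, j + 1 ≤ l → l ≤ L → t l = 1 :=
  ⟨Nat.findGreatest (t · ≠ 1) L, Nat.le_findGreatest hij hi, Nat.findGreatest_le L,
    Nat.findGreatest_spec (P := (t · ≠ 1)) hij hi,
    fun _ hl hlL ↦ not_not.1 (Nat.findGreatest_is_greatest hl hlL)⟩

end Digits

/-! ### Generalized Thabit semigroups -/

/-- The common factor of the increments: `s n k i = s n k 0 + step n k * (2 ^ i - 1)`. -/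
def step (n k : ℕ) : ℕ := (2 ^ k + 1) * 2 ^ n

section Thabit

variable {n k d j : ℕ} {t : ℕ → ℕ}

theorem step_eq (n k : ℕ) : step n k = 2 ^ (n + k) + 2 ^ n := by
  rw [step]
  ring

theorem s_zero_add (n k : ℕ) : s n k 0 + 2 ^ k = 2 ^ (n + k) + 2 ^ n + 1 := by
  have hk := Nat.two_pow_pos k
  have hle : 2 ^ k ≤ 2 ^ (n + k) := Nat.pow_le_pow_right two_pos (Nat.le_add_left k n)
  have hn := Nat.two_pow_pos n
  have hs : s n k 0 = step n k - (2 ^ k - 1) := rfl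
  rw [hs, step_eq]
  omega

theorem s_eq (n k i : ℕ) : s n k i = s n k 0 + step n k * (2 ^ i - 1) := by
  have hs0 := s_zero_add n k
  have hstep := step_eq n k
  have hs : s n k i = step n k * 2 ^ i - (2 ^ k - 1) := by rw [s, step, pow_add, mul_assoc]
  have hle : step n k * 1 ≤ step n k * 2 ^ i := Nat.mul_le_mul_left _ (Nat.two_pow_pos i)
  have hpos := Nat.two_pow_pos k
  rw [hs, Nat.mul_sub]
  omega

theorem s_zero_ne_zero (n k : ℕ) : s n k 0 ≠ 0 := by
  have hs := s_zero_add n k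
  have hle : 2 ^ k ≤ 2 ^ (n + k) := Nat.pow_le_pow_right two_pos (Nat.le_add_left k n)
  have hn := Nat.two_pow_pos n
  omega

theorem step_eq_s_zero_add (n k : ℕ) : step n k = s n k 0 + (2 ^ k - 1) := by
  have hs := s_zero_add n k
  have hpos := Nat.two_pow_pos k
  rw [step_eq]
  omega

theorem coprime_s_zero_step (n : ℕ) (hk : 1 ≤ k) : (s n k 0).Coprime (step n k) := by
  have htwo : (2 ^ k - 1).Coprime 2 := by
    rw [Nat.coprime_two_right]
    exact Nat.Even.sub_odd Nat.one_le_two_pow ((even_two).pow_of_ne_zero (by omega)) odd_one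
  have hsucc : (2 ^ k - 1).Coprime (2 ^ k + 1) := by
    have := Nat.two_pow_pos k
    rwa [show 2 ^ k + 1 = 2 ^ k - 1 + 2 by omega, Nat.coprime_self_add_right]
  have hstep : (step n k).Coprime (2 ^ k - 1) := (hsucc.mul_right (htwo.pow_right n)).symm
  rw [step_eq_s_zero_add, Nat.coprime_add_self_left] at hstep
  rwa [step_eq_s_zero_add, Nat.coprime_self_add_right]

theorem GT_eq_mersenneMonoid (n k : ℕ) : GT n k = mersenneMonoid (s n k 0) (step n k) := by
  rw [GT, mersenneMonoid]
  congr 2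
  exact funext (s_eq n k)

theorem s_zero_mem_GT (n k : ℕ) : s n k 0 ∈ GT n k := AddSubmonoid.subset_closure ⟨0, rfl⟩

theorem finite_compl_GT (n : ℕ) (hk : 1 ≤ k) : (GT n k : Set ℕ)ᶜ.Finite := by
  rw [GT_eq_mersenneMonoid]
  exact finite_compl_mersenneMonoid (coprime_s_zero_step n hk)

theorem Apery_GT (n : ℕ) (hk : 1 ≤ k) : Apery (GT n k) (s n k 0) =
    ((Finset.range (s n k 0)).image
      fun p ↦ s n k 0 * mersenneLength p + step n k * p : Finset ℕ) := by
  rw [GT_eq_mersenneMonoid]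
  exact Apery_mersenneMonoid (s_zero_ne_zero n k) (coprime_s_zero_step n hk)
    (step_eq_s_zero_add n k ▸ Nat.le_add_right _ _)

theorem Q_eq (n k : ℕ) (t : ℕ → ℕ) (L : ℕ) :
    Q n k t L = s n k 0 * digitSum t L + step n k * P t L := by
  rw [Q, digitSum, P, Finset.mul_sum, Finset.mul_sum, ← Finset.sum_add_distrib]
  refine Finset.sum_congr rfl fun j _ ↦ ?_
  rw [s_eq n k j]
  ring

theorem mem_A_iff : t ∈ A n d ↔
    (∀ i, i ∉ Finset.Icc 1 (n + d) → t i = 0) ∧ IsGreedy t ∧ t (n + d) ≤ 1 := by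
  have hle2 : ∀ c : ℕ, c ∈ ({0, 1, 2} : Set ℕ) ↔ c ≤ 2 := fun c ↦ by
    simp only [Set.mem_insert_iff, Set.mem_singleton_iff]; omega
  have hle1 : ∀ c : ℕ, c ∈ ({0, 1} : Set ℕ) ↔ c ≤ 1 := fun c ↦ by
    simp only [Set.mem_insert_iff, Set.mem_singleton_iff]; omega
  simp only [A, Set.mem_ofPred_eq, hle2, hle1]
  refine and_congr_right fun hsupp ↦ ⟨fun ⟨hle, htop, htwo⟩ ↦ ⟨fun j ↦ ?_, htop⟩,
    fun ⟨ht, htop⟩ ↦ ⟨fun j _ ↦ (ht j).1, htop, fun j _ ↦ (ht j).2⟩⟩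
  by_cases hj : j ∈ Finset.Icc 1 (n + d)
  · exact ⟨hle j hj, htwo j hj⟩
  · simp [hsupp j hj]

theorem delta_of_le (hn : n ≠ 0) (hkn : k ≤ n) : delta n k = k := by
  rw [delta, if_neg hn, if_pos hkn]

theorem delta_of_lt (hn : n ≠ 0) (hnk : n < k) : delta n k = k - 1 := by
  rw [delta, if_neg hn, if_neg (by omega)]

theorem s_zero_add_two_le (hk : 1 ≤ k) (h : n = 1 → k ≠ 2) :
    s n k 0 + 2 ≤ 2 ^ (n + delta n k + 1) := by
  have hs := s_zero_add n k
  have htwo_le : 2 ^ 1 ≤ 2 ^ k := Nat.pow_le_pow_right two_pos hk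
  obtain rfl | hn := eq_or_ne n 0
  · simp only [zero_add, pow_zero] at hs
    simp only [delta, if_true, zero_add]
    omega
  obtain hkn | hnk := le_or_gt k n
  · have hpow : 2 ^ (n + 1) ≤ 2 ^ (n + k) := Nat.pow_le_pow_right two_pos (by omega)
    have hn2 : 2 ^ 1 ≤ 2 ^ n := Nat.pow_le_pow_right two_pos (by omega)
    rw [delta_of_le hn hkn]
    omega
  · have hpow : 2 ^ (n + 1) ≤ 2 ^ k := Nat.pow_le_pow_right two_pos hnk
    have hk3 : 2 ^ 3 ≤ 2 ^ k := Nat.pow_le_pow_right two_pos (by omega)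
    rw [delta_of_lt hn hnk, show n + (k - 1) + 1 = n + k by omega]
    omega

/-- The digit sequences `t ∈ A n δ` with `P t (n + δ) < s n k 0`, where `δ = delta n k`. Unless
`n = 1` and `k = 2`, they parametrize `Apery (GT n k) (s n k 0)`. -/
def aperyDigits (n k : ℕ) : Set (ℕ → ℕ) :=
  {t | t ∈ A n (delta n k) ∧ P t (n + delta n k) < s n k 0}

theorem Apery_GT_eq_Q (hk : 1 ≤ k) (h : n = 1 → k ≠ 2) : Apery (GT n k) (s n k 0) =
    {w | ∃ t ∈ aperyDigits n k, w = Q n k t (n + delta n k)} := by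
  have hs := s_zero_add_two_le hk h
  ext w
  simp only [Apery_GT n hk, Finset.coe_image, Finset.coe_range, Set.mem_image, Set.mem_Iio,
    Set.mem_ofPred_eq]
  constructor
  · rintro ⟨p, hp, rfl⟩
    obtain ⟨t, ht, hsupp, rfl⟩ := IsGreedy.exists_P_eq (L := n + delta n k) (p := p) (by omega)
    refine ⟨t, ⟨mem_A_iff.2 ⟨hsupp, ht, ?_⟩, hp⟩, by rw [Q_eq, ht.mersenneLength_P]⟩
    by_contra! htop
    have hmem : n + delta n k ∈ Finset.Icc 1 (n + delta n k) := by
      by_contra hmem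
      rw [hsupp _ hmem] at htop
      omega
    have hP := (Nat.mul_le_mul_left _ htop).trans (mul_le_P (Finset.mem_Icc.1 hmem).1 le_rfl)
    omega
  · rintro ⟨t, ⟨hA, hP⟩, rfl⟩
    exact ⟨_, hP, by rw [Q_eq, (mem_A_iff.1 hA).2.1.mersenneLength_P]⟩

theorem P_lt_s_zero_iff_of_le (hk : 1 ≤ k) (hkn : k ≤ n) (ht : t ∈ A n k) :
    P t (n + k) < s n k 0 ↔ (t (n + k) = 1 → P t (n + k - 1) + 2 ^ k ≤ 2 ^ n + 1) := by
  obtain ⟨-, hgreedy, htop⟩ := mem_A_iff.1 ht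
  have hs := s_zero_add n k
  have hpow : 2 ^ k ≤ 2 ^ n := Nat.pow_le_pow_right two_pos hkn
  obtain ⟨L, hL⟩ : ∃ L, n + k = L + 1 := ⟨n + k - 1, by omega⟩
  have hP := hgreedy.P_add_two_le L
  rw [hL] at hs htop ⊢
  rw [P_succ, Nat.add_sub_cancel]
  interval_cases t (L + 1) <;> omega

theorem aperyDigits_eq_R (hn : n ≠ 0) : aperyDigits n 1 = R n := by
  ext t
  rw [aperyDigits, R, delta_of_le hn (by omega)]
  refine and_congr_right fun hA ↦ ?_
  obtain ⟨-, hgreedy, htop⟩ := mem_A_iff.1 hA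
  obtain ⟨m, rfl⟩ := Nat.exists_eq_succ_of_ne_zero hn
  have hzero : (∀ i, 1 ≤ i → i < m + 1 → t i = 0) ↔ P t m = 0 := by
    simp only [P_eq_zero_iff, Nat.lt_succ_iff]
  rw [P_lt_s_zero_iff_of_le le_rfl (by omega) hA]
  have hlt : P t (m + 1) + 2 ^ 1 ≤ 2 ^ (m + 1) + 1 ↔ P t (m + 1) < 2 ^ (m + 1) := by omega
  simp only [Nat.succ_eq_add_one, Nat.add_sub_cancel, hlt, hgreedy.P_lt_two_pow_iff, hzero,
    Set.mem_insert_iff, Set.mem_singleton_iff] at htop ⊢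
  omega

theorem aperyDigits_eq_R₁ (hk : 2 ≤ k) (hkn : k < n) : aperyDigits n k = R₁ n k := by
  ext t
  rw [aperyDigits, R₁, delta_of_le (by omega) hkn.le]
  refine and_congr_right fun hA ↦ ?_
  obtain ⟨-, hgreedy, -⟩ := mem_A_iff.1 hA
  obtain ⟨m, rfl⟩ : ∃ m, n = m + 2 := ⟨n - 2, by omega⟩
  have hk4 : 2 ^ 2 ≤ 2 ^ k := Nat.pow_le_pow_right two_pos hk
  have hm : 2 ^ (m + 2) = 2 ^ (m + 1) * 2 := pow_succ 2 (m + 1)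
  have hkm : 2 ^ k ≤ 2 ^ (m + 1) := Nat.pow_le_pow_right two_pos (by omega)
  have hPm := hgreedy.P_add_two_le m
  have hle := (hgreedy (m + 1)).1
  have hsub : P t (m + 2 + k - 1) + 2 ^ k ≤ 2 ^ (m + 2) + 1 ↔
      P t (m + 2 + k - 1) ≤ 2 ^ (m + 2) + 1 - 2 ^ k := by omega
  rw [P_lt_s_zero_iff_of_le (by omega) hkn.le hA]
  refine imp_congr_right fun _ ↦ ?_
  rw [hsub, P_le_iff (i := m + 1) (by omega) (by omega)]
  refine and_congr_right fun _ ↦ ?_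
  rw [P_succ]
  simp only [Nat.add_sub_cancel, show m + 2 - 1 = m + 1 from rfl, Set.mem_insert_iff,
    Set.mem_singleton_iff]
  interval_cases t (m + 1) <;> omega

theorem aperyDigits_eq_R₂ (hn : 1 ≤ n) : aperyDigits n n = R₂ n n := by
  ext t
  rw [aperyDigits, R₂, delta_of_le (by omega) le_rfl]
  refine and_congr_right fun hA ↦ ?_
  have hle : ∀ p, p + 2 ^ n ≤ 2 ^ n + 1 ↔ p ≤ 1 := by omega
  rw [P_lt_s_zero_iff_of_le hn le_rfl hA, two_mul, hle, P_le_iff (i := 1) (by omega) (by norm_num),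
    P_one, and_comm]
  refine imp_congr_right fun _ ↦ and_congr_left fun _ ↦ ?_
  simp only [Set.mem_insert_iff, Set.mem_singleton_iff]
  omega

theorem P_lt_s_zero_iff_of_eq_one (hones : ∀ i, d + 1 ≤ i → i ≤ n + d → t i = 1) :
    P t (n + d) < s n (d + 1) 0 ↔ P t d ≤ 2 ^ n + n := by
  have hs := s_zero_add n (d + 1)
  have hP := P_add_of_eq_one (Nat.le_add_left d n) hones
  rw [← add_assoc] at hs
  omega

theorem IsGreedy.P_lt_s_zero_of_eq_zero (ht : IsGreedy t) (hdj : d + 1 ≤ j) (hj : j ≤ n + d)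
    (htj : t j = 0) (hones : ∀ i, j + 1 ≤ i → i ≤ n + d → t i = 1) :
    P t (n + d) < s n (d + 1) 0 := by
  have hs := s_zero_add n (d + 1)
  have hP := ht.P_add_le_of_eq_zero (by omega) hj htj hones
  have hpow : 2 ^ (d + 1) ≤ 2 ^ j := Nat.pow_le_pow_right two_pos hdj
  have hn := Nat.two_pow_pos n
  rw [← add_assoc] at hs
  omega

theorem IsGreedy.s_zero_le_P_of_eq_two (ht : IsGreedy t) (hnd : n ≤ d) (hdj : d + 1 ≤ j)
    (hj : j < n + d) (htj : t j = 2) (hones : ∀ i, j + 1 ≤ i → i ≤ n + d → t i = 1) :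
    s n (d + 1) 0 ≤ P t (n + d) := by
  have hs := s_zero_add n (d + 1)
  have hP := ht.P_add_of_eq_two (by omega) hj.le htj hones
  have hpow : 2 ^ (n + 1) ≤ 2 ^ (d + 1) := Nat.pow_le_pow_right two_pos (by omega)
  have hn : n - 1 < 2 ^ (n - 1) := Nat.lt_two_pow_self
  have hn_pow : 2 ^ n = 2 ^ (n - 1) * 2 := by rw [← pow_succ, Nat.sub_add_cancel (by omega)]
  rw [← add_assoc] at hs
  omega

theorem aperyDigits_eq_R₃ (hn : n ≠ 0) (hnk : n < k) : aperyDigits n k = R₃ n k := by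
  ext t
  rw [aperyDigits, R₃, delta_of_lt hn hnk]
  refine and_congr_right fun hA ↦ ?_
  obtain ⟨-, hgreedy, htop⟩ := mem_A_iff.1 hA
  obtain ⟨d, rfl⟩ : ∃ d, k = d + 1 := ⟨k - 1, by omega⟩
  rw [Nat.add_sub_cancel] at *
  constructor
  · refine fun hP ↦ ⟨fun hones ↦ (P_lt_s_zero_iff_of_eq_one hones).1 hP, ?_⟩
    rintro ⟨j, hdj, hj, htj, hones⟩
    exact hP.not_ge (hgreedy.s_zero_le_P_of_eq_two (by omega) hdj (by omega) htj hones)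
  · rintro ⟨hall, hnot_two⟩
    by_cases hones : ∀ i, d + 1 ≤ i → i ≤ n + d → t i = 1
    · exact (P_lt_s_zero_iff_of_eq_one hones).2 (hall hones)
    push Not at hones
    obtain ⟨i, hdi, hi, hti⟩ := hones
    obtain ⟨j, hij, hj, htj, hones⟩ := exists_last_ne_one hi hti
    have htj0 : t j = 0 := by
      have hle := (hgreedy j).1
      have htwo : t j ≠ 2 := fun h ↦ by
        obtain rfl | hlt := hj.eq_or_lt
        · omega
        · exact hnot_two ⟨j, by omega, by omega, h, hones⟩
      omega
    exact hgreedy.P_lt_s_zero_of_eq_zero (by omega) hj htj0 hones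

theorem mersenneLength_zero : mersenneLength 0 = 0 :=
  Nat.le_zero.1 (mersenneLength_le_self 0)

theorem mersenneLength_one : mersenneLength 1 = 1 :=
  mersenneLength_eq (self_mem_mersenneSums 1) (by simp [bitCount])

theorem Apery_GT_zero (hk : 1 ≤ k) : Apery (GT 0 k) (s 0 k 0) = {0, s 0 k 1} := by
  have hs : s 0 k 0 = 2 := by
    have := s_zero_add 0 k
    simp only [zero_add, pow_zero] at this
    omega
  rw [Apery_GT 0 hk, s_eq 0 k 1, hs]
  simp [Finset.range_add_one, mersenneLength_zero, mersenneLength_one, Set.pair_comm]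

theorem Apery_GT_one_two : Apery (GT 1 2) (s 1 2 0) = {0, 17, 34, 37, 54, 71, 74} := by
  have hs : s 1 2 0 = 7 := rfl
  have hstep : step 1 2 = 10 := rfl
  have h2 : mersenneLength 2 = 2 :=
    mersenneLength_eq (self_mem_mersenneSums 2) (by simp [bitCount])
  have h3 : mersenneLength 3 = 1 :=
    mersenneLength_eq (one_mem_mersenneSums 2) (by simp [bitCount])
  have h4 : mersenneLength 4 = 2 :=
    mersenneLength_eq (mersenneSums.add_mem (one_mem_mersenneSums 2) (one_mem_mersenneSums 1))
      (by simp [bitCount])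
  have h5 : mersenneLength 5 = 3 :=
    mersenneLength_eq (mersenneSums.add_mem (one_mem_mersenneSums 2) (self_mem_mersenneSums 2))
      (by simp [bitCount])
  have h6 : mersenneLength 6 = 2 :=
    mersenneLength_eq (mersenneSums.add_mem (one_mem_mersenneSums 2) (one_mem_mersenneSums 2))
      (by simp [bitCount])
  rw [Apery_GT 1 one_le_two, hs, hstep]
  ext w
  simp only [Finset.range_add_one, Finset.range_zero, Finset.image_insert, Finset.image_empty,
    mersenneLength_zero, mersenneLength_one, h2, h3, h4, h5, h6,
    Finset.coe_insert, Finset.coe_empty, Set.mem_insert_iff, Set.mem_singleton_iff,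
    Set.mem_empty_iff_false]
  norm_num [or_comm, or_left_comm, or_assoc]

end Thabit

end GenThabit

theorem mainTheorem4 (n k : ℕ) (hk : 1 ≤ k) :
    (n = 0 →
      GenThabit.Apery (GenThabit.GT n k) (GenThabit.s n k 0) = {0, GenThabit.s n k 1}) ∧
    (n ≠ 0 → k = 1 →
      GenThabit.Apery (GenThabit.GT n k) (GenThabit.s n k 0) =
        {w | ∃ t ∈ GenThabit.R n, w = GenThabit.Q n k t (n + 1)}) ∧
    (2 ≤ k → k < n →
      GenThabit.Apery (GenThabit.GT n k) (GenThabit.s n k 0) =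
        {w | ∃ t ∈ GenThabit.R₁ n k, w = GenThabit.Q n k t (n + GenThabit.delta n k)}) ∧
    (n = k → 1 ≤ k →
      GenThabit.Apery (GenThabit.GT n k) (GenThabit.s n k 0) =
        {w | ∃ t ∈ GenThabit.R₂ n k, w = GenThabit.Q n k t (n + GenThabit.delta n k)}) ∧
    (n ≠ 0 → k ≠ 2 → n < k →
      GenThabit.Apery (GenThabit.GT n k) (GenThabit.s n k 0) =
        {w | ∃ t ∈ GenThabit.R₃ n k, w = GenThabit.Q n k t (n + GenThabit.delta n k)}) ∧
    (n = 1 → k = 2 →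
      GenThabit.Apery (GenThabit.GT n k) (GenThabit.s n k 0) = {0, 17, 34, 37, 54, 71, 74}) ∧
    (GenThabit.Apery (GenThabit.GT n k) (GenThabit.s n k 0)).Finite ∧
    (GenThabit.Apery (GenThabit.GT n k) (GenThabit.s n k 0)).ncard = GenThabit.s n k 0 ∧
    ((GenThabit.GT n k : Set ℕ)ᶜ).Finite ∧
    (GenThabit.genus (GenThabit.GT n k) : ℚ) =
      1 / (GenThabit.s n k 0 : ℚ) *
          (∑ᶠ w ∈ GenThabit.Apery (GenThabit.GT n k) (GenThabit.s n k 0), (w : ℚ)) -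
        ((GenThabit.s n k 0 : ℚ) - 1) / 2 := by
  have hmem := GenThabit.s_zero_mem_GT n k
  have hs0 := GenThabit.s_zero_ne_zero n k
  have hfin := GenThabit.finite_compl_GT n hk
  refine ⟨?_, ?_, ?_, ?_, ?_, ?_, GenThabit.finite_Apery hmem hs0,
    GenThabit.ncard_Apery hfin hmem hs0, hfin, GenThabit.genus_eq hfin hmem hs0⟩
  · rintro rfl
    exact GenThabit.Apery_GT_zero hk
  · rintro hn rfl
    rw [GenThabit.Apery_GT_eq_Q hk (by omega), GenThabit.aperyDigits_eq_R hn,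
      GenThabit.delta_of_le hn (by omega)]
  · intro h2 hkn
    rw [GenThabit.Apery_GT_eq_Q hk (by omega), GenThabit.aperyDigits_eq_R₁ h2 hkn]
  · rintro rfl -
    rw [GenThabit.Apery_GT_eq_Q hk (by omega), GenThabit.aperyDigits_eq_R₂ hk]
  · intro hn h2 hnk
    rw [GenThabit.Apery_GT_eq_Q hk (fun _ ↦ h2), GenThabit.aperyDigits_eq_R₃ hn hnk]
  · rintro rfl rfl
    exact GenThabit.Apery_GT_one_two
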